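/- There is an absolute constant $\gamma>0$ such that the following holds. Let $R=(r_1,\dots,r_m)$ and $C=(c_1,\dots,c_n)$ be vectors of positive integers. Let $A_0(R,C)$ be the set of $m\times n$ matrices $D=(d_{ij})$ with $d_{ij}\in\{0,1\}$, row sums $\sum_{j} d_{ij}=r_i$ $(1\le i\le m)$ and column sums $\sum_i d_{ij}=c_j$ $(1\le j\le n)$, and let $P_0(R,C)$ be the polytope of real $m\times n$ matrices with the same row and column sums and all entries in $[0,1]$. Suppose that $P_0(R,C)$ has a non-empty interior, that is, contains a matrix $Y=(y_{ij})$ with $0<y_{ij}<1$ for all $i,j$. Let $Z_0\in P_0(R,C)$ be the maximum entropy matrix, that is, the point of $P_0(R,C)$ at which $$h(X)=\sum_{i,j}\left(x_{ij}\ln\frac1{x_{ij}}+(1-x_{ij})\ln\frac1{1-x_{ij}}\right)\qquad (0\ln\tfrac10=0)$$ attains its maximum on $P_0(R,C)$. Let $X=(x_{ij})$ be a random $m\times n$ matrix of independent Bernoulli ($\{0,1\}$-valued) random variables $x_{ij}$ such that $\mathbf E\,X=Z_0$. Then: (1) the probability mass function of $X$ is constant on $A_0(R,C)$, and $$\mathbf{Pr}\{X=D\}=e^{-h(Z_0)}\quad\text{for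 all } D\in A_0(R,C);$$ (2) $$\mathbf{Pr}\{X\in A_0(R,C)\}\ \ge\ (mn)^{-\gamma(m+n)}.$$ -/

import Mathlib

open MeasureTheory ProbabilityTheory

noncomputable section

namespace Margins

/-- The set `A₀(R, C)` of `m × n` matrices with entries in `{0, 1}`, row sums `R` and column
sums `C`. -/
def zeroOneMatrices {m n : ℕ} (R : Fin m → ℕ) (C : Fin n → ℕ) :
    Set (Matrix (Fin m) (Fin n) ℝ) :=
  {D | (∀ i, ∑ j, D i j = (R i : ℝ)) ∧ (∀ j, ∑ i, D i j = (C j : ℝ)) ∧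
    ∀ i j, D i j = 0 ∨ D i j = 1}

/-- The polytope `P₀(R, C)` of real `m × n` matrices with entries in `[0, 1]`, row sums `R` and
column sums `C`. -/
def polytope {m n : ℕ} (R : Fin m → ℕ) (C : Fin n → ℕ) :
    Set (Matrix (Fin m) (Fin n) ℝ) :=
  {X | (∀ i, ∑ j, X i j = (R i : ℝ)) ∧ (∀ j, ∑ i, X i j = (C j : ℝ)) ∧
    ∀ i j, 0 ≤ X i j ∧ X i j ≤ 1}

/-- `P₀(R, C)` has a non-empty interior: it contains a matrix all of whose entries lie strictly
between `0` and `1`. -/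
def HasNonemptyInterior {m n : ℕ} (R : Fin m → ℕ) (C : Fin n → ℕ) : Prop :=
  ∃ Y ∈ polytope R C, ∀ i j, 0 < Y i j ∧ Y i j < 1

/-- The entropy `h(X) = ∑ᵢⱼ (xᵢⱼ ln (1 / xᵢⱼ) + (1 - xᵢⱼ) ln (1 / (1 - xᵢⱼ)))`, with the usual
convention `0 ln (1 / 0) = 0`. -/
def entropy {m n : ℕ} (X : Matrix (Fin m) (Fin n) ℝ) : ℝ :=
  ∑ i, ∑ j, Real.binEntropy (X i j)

/-- `Z` is the maximum entropy matrix of `P₀(R, C)`: it lies in the polytope and maximizes the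
entropy there. -/
def IsMaxEntropyMatrix {m n : ℕ} (R : Fin m → ℕ) (C : Fin n → ℕ)
    (Z : Matrix (Fin m) (Fin n) ℝ) : Prop :=
  Z ∈ polytope R C ∧ ∀ X ∈ polytope R C, entropy X ≤ entropy Z

/-- `x` is a Bernoulli random variable: it takes the value `1` with probability `q` and the value
`0` with probability `1 - q`, for some `q ∈ [0, 1]`. -/
def IsBernoulli {Ω : Type*} [MeasurableSpace Ω] (μ : Measure Ω) (x : Ω → ℝ) : Prop :=
  ∃ q : unitInterval, HasLaw x (bernoulliMeasure (1 : ℝ) 0 q) μ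

/-- `X` is a random matrix of independent Bernoulli random variables with expectation `Z`. -/
structure IsBernoulliMatrix {Ω : Type*} [MeasurableSpace Ω] (μ : Measure Ω) {m n : ℕ}
    (X : Ω → Matrix (Fin m) (Fin n) ℝ) (Z : Matrix (Fin m) (Fin n) ℝ) : Prop where
  bernoulli : ∀ i j, IsBernoulli μ (fun ω => X ω i j)
  indep : iIndepFun (fun (p : Fin m × Fin n) (ω : Ω) => X ω p.1 p.2) μ
  expectation : ∀ i j, ∫ ω, X ω i j ∂μ = Z i j

end Margins

end

namespace Margins

open Finset

/-! ### Balanced two-colourings of bipartite multigraphs -/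

/-! At the maximizer `Z`, which is interior because the entropy has infinite slope at the boundary,
the gradient of the entropy is orthogonal to `D - Z` for every `D` in the polytope. For a 0-1 matrix
`D` the log-probability of `D` is `-entropy Z` minus exactly this linear term, which gives the
constant mass. Part (2) therefore amounts to the lower bound `exp (entropy Z) ≤ N ^ (3 * (m + n)) *
|A₀|` with `N = m * n`.

The counting bound rests on approximate midpoint log-concavity (`card_pairs_le`): pairs of edge sets
whose degrees add up to twice the target are at most polynomially (per vertex) more numerous than
pairs in which each set meets the target. Fix the union and the intersection of a pair. The edges
where the two sets differ form a bipartite multigraph with even degrees, and the claim is that a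
fair share of its two-colourings is balanced at every vertex (`two_pow_le_card_balanced`). To see
this, pair up the edges at every vertex. The row pairing and the column pairing are two perfect
matchings of the edges, so some colouring flips along both and is hence balanced, while each
balanced colouring serves only few pairings.

Replace each cell by `K = 2 ^ s` copies. Halving `K` repeatedly costs a factor whose `2 ^ s`-th root
stays bounded (`blowupCount_two_pow_le`). In the other direction, an integer rounding of `K * Z`
with the exact margins gives at least a product of binomial coefficients, that is, `exp (K * entropy
Z)` up to a factor polynomial in `K`. Taking `K`-th roots and letting `s → ∞` gives the bound. -/

/-- A fixed-point-free involution admits a two-colouring that it flips. -/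
theorem exists_flip_of_involutive {Q : Type*} (f : Q → Q) (hf : ∀ q, f (f q) = q)
    (hf' : ∀ q, f q ≠ q) : ∃ c : Q → Bool, ∀ q, c (f q) = !c q := by
  classical
  -- Colour `q` by whether it is the smaller element of its pair, in an arbitrary well-order.
  refine ⟨fun q => decide (WellOrderingRel q (f q)), fun q => ?_⟩
  simp only [hf]
  rcases trichotomous_of (WellOrderingRel (α := Q)) q (f q) with h | h | h
  · have h' : ¬ WellOrderingRel (f q) q := fun h' => asymm_of WellOrderingRel h h'
    simp [h, h']
  · exact absurd h.symm (hf' q)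
  · have h' : ¬ WellOrderingRel q (f q) := fun h' => asymm_of WellOrderingRel h h'
    simp [h, h']

/-- The union of two perfect matchings is bipartite. -/
theorem exists_flip_coloring {T : Type*} (f g : T → T) (hf : ∀ x, f (f x) = x)
    (hg : ∀ x, g (g x) = x) (hf' : ∀ x, f x ≠ x) (hg' : ∀ x, g x ≠ x) :
    ∃ c : T → Bool, (∀ x, c (f x) = !c x) ∧ ∀ x, c (g x) = !c x := by
  classical
  let a : Equiv.Perm T := Function.Involutive.toPerm f hf
  let b : Equiv.Perm T := Function.Involutive.toPerm g hg
  let σ : Equiv.Perm T := a * b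
  have haa : a * a = 1 := Equiv.ext hf
  have hbb : b * b = 1 := Equiv.ext hg
  have hainv : a⁻¹ = a := inv_eq_of_mul_eq_one_left haa
  have hbinv : b⁻¹ = b := inv_eq_of_mul_eq_one_left hbb
  -- Dihedral relation: two involutions conjugate their product to its inverse.
  have hconj : a * σ * a⁻¹ = σ⁻¹ := by
    simp only [σ, mul_inv_rev, hbinv, hainv]
    rw [← mul_assoc, haa, one_mul]
  have hpow : ∀ i : ℤ, a * σ ^ i = σ ^ (-i) * a := fun i => by
    have h := conj_zpow (a := a) (b := σ) (i := i)
    rw [hconj, inv_zpow'] at h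
    rw [h]
    group
  have hpow' : ∀ (i : ℤ) (x : T), f ((σ ^ i) x) = (σ ^ (-i)) (f x) := fun i x =>
    DFunLike.congr_fun (hpow i) x
  have hgf : ∀ x, g x = f (σ x) := fun x => (hf (g x)).symm
  -- The colouring is sought constant on the cycles of `σ`, with `f` swapping cycles; then `g = f ∘
  -- σ` flips it as well.
  let s := Equiv.Perm.SameCycle.setoid σ
  let F : Quotient s → Quotient s := Quotient.map f (by
    rintro x y ⟨i, rfl⟩
    exact ⟨-i, (hpow' i x).symm⟩)
  have hF : ∀ q, F (F q) = q := by
    rintro ⟨x⟩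
    exact congrArg (Quotient.mk s) (hf x)
  have hF' : ∀ q, F q ≠ q := by
    rintro ⟨x⟩ h
    -- If `f x = σ ^ j x`, the midpoint `σ ^ i x` is fixed by `f` when `j = 2 * i` and by `g` when
    -- `j = 2 * i + 1`.
    obtain ⟨j, hj⟩ : σ.SameCycle x (f x) := (Quotient.exact h).symm
    rcases Int.even_or_odd' j with ⟨i, rfl | rfl⟩
    · apply hf' ((σ ^ i) x)
      rw [hpow', ← hj, ← Equiv.Perm.mul_apply, ← zpow_add]
      congr 2
      ring
    · apply hg' ((σ ^ i) x)
      have : σ ((σ ^ i) x) = (σ ^ (i + 1)) x := by rw [add_comm, zpow_add, zpow_one]; rfl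
      rw [hgf, this, hpow', ← hj, ← Equiv.Perm.mul_apply, ← zpow_add]
      congr 2
      ring
  obtain ⟨c, hc⟩ := exists_flip_of_involutive F hF hF'
  refine ⟨fun x => c (Quotient.mk s x), fun x => hc (Quotient.mk s x), fun x => ?_⟩
  have h1 : Quotient.mk s (σ x) = Quotient.mk s x :=
    Quotient.sound (s := s) (show σ.SameCycle (σ x) x from ⟨-1, by simp⟩)
  have h2 := hc (Quotient.mk s (σ x))
  rw [h1] at h2
  simp only [hgf x]
  rw [← h2, ← h1]
  rfl

open scoped Nat in
/-- The number of bijections that carry one two-colouring to another. -/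
theorem card_equiv_coloring_le {α β : Type*} [Fintype α] [Fintype β] [DecidableEq α]
    [DecidableEq β] (c : α → Bool) (F : β → Bool) :
    #{h : α ≃ β | ∀ x, F (h x) = c x} ≤ (#{x | c x = true}) ! * (#{x | c x = false}) ! := by
  classical
  rcases Finset.eq_empty_or_nonempty ({h : α ≃ β | ∀ x, F (h x) = c x} : Finset (α ≃ β))
    with h0 | ⟨h₀, hh₀⟩
  · simp [h0]
  have key : ∀ h : {h : α ≃ β // ∀ x, F (h x) = c x}, ∀ b : Bool, ∀ x, c x = b ↔ F (h.1 x) = b :=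
    fun h b x => by rw [h.2]
  let G : {h : α ≃ β // ∀ x, F (h x) = c x} →
      ({x // c x = true} ≃ {y // F y = true}) × ({x // c x = false} ≃ {y // F y = false}) :=
    fun h => ⟨h.1.subtypeEquiv (key h true), h.1.subtypeEquiv (key h false)⟩
  have hG : Function.Injective G := by
    intro h h' hh
    apply Subtype.ext
    ext x
    cases hx : c x
    · exact congrArg Subtype.val (DFunLike.congr_fun (Prod.ext_iff.1 hh).2 ⟨x, hx⟩)
    · exact congrArg Subtype.val (DFunLike.congr_fun (Prod.ext_iff.1 hh).1 ⟨x, hx⟩)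
  have hle := Fintype.card_le_of_injective G hG
  have g₀ := G ⟨h₀, by simpa using hh₀⟩
  rw [Fintype.card_prod, Fintype.card_equiv g₀.1, Fintype.card_equiv g₀.2] at hle
  simpa only [Fintype.card_subtype] using hle

open scoped Nat in
/-- The number of labelings of a balanced set whose pairs are bicoloured. -/
theorem card_compatible_labelings_le {α : Type*} [Fintype α] [DecidableEq α] {k : ℕ}
    (hα : Fintype.card α = 2 * k) (c : α → Bool) (hc : #{x | c x = true} = k) :
    #{h : α ≃ Fin k × Bool | ∀ i, c (h.symm (i, true)) = !c (h.symm (i, false))} ≤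
      2 ^ k * (k ! * k !) := by
  classical
  have hc' : #{x | c x = false} = k := by
    have h := card_filter_add_card_filter_not (s := (univ : Finset α)) (fun x => c x = true)
    simp only [Bool.not_eq_true, Finset.card_univ] at h
    omega
  -- Sort the labelings by the colour of the `true` end of each pair, `2 ^ k` patterns in all. A
  -- fixed pattern colours the target, and the labeling must carry `c` to that colouring.
  have := Finset.card_le_mul_card_image_of_maps_to
    (s := {h : α ≃ Fin k × Bool | ∀ i, c (h.symm (i, true)) = !c (h.symm (i, false))})
    (t := (univ : Finset (Fin k → Bool))) (f := fun h i => c (h.symm (i, true)))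
    (fun _ _ => mem_univ _) (k ! * k !) (fun f _ => ?_)
  · simpa [mul_comm] using this
  · refine le_trans (card_le_card ?_)
      ((card_equiv_coloring_le c fun y => if y.2 then f y.1 else !f y.1).trans_eq (by rw [hc, hc']))
    intro h
    simp only [mem_filter, mem_univ, true_and]
    rintro ⟨h1, rfl⟩ x
    obtain ⟨⟨i, b⟩, rfl⟩ := h.symm.surjective x
    cases b <;> simp [h1 i]

/-! ### Pairings of the edges at each vertex -/

/-- Labelings of the fibres of `p` by pairs. -/
abbrev Labeling {T U : Type*} (p : T → U) (k : U → ℕ) : Type _ :=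
  ∀ u, {e // p e = u} ≃ Fin (k u) × Bool

/-- The pairing of the fibres that a labeling induces. -/
def Labeling.flip {T U : Type*} {p : T → U} {k : U → ℕ} (h : Labeling p k) (e : T) : T :=
  ((h (p e)).symm ((h (p e) ⟨e, rfl⟩).1, !(h (p e) ⟨e, rfl⟩).2)).1

theorem Labeling.flip_coe {T U : Type*} {p : T → U} {k : U → ℕ} (h : Labeling p k) (u : U)
    (x : {e // p e = u}) : h.flip x = ((h u).symm ((h u x).1, !(h u x).2)).1 := by
  obtain ⟨e, rfl⟩ := x
  rfl

theorem Labeling.flip_flip {T U : Type*} {p : T → U} {k : U → ℕ} (h : Labeling p k) (e : T) :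
    h.flip (h.flip e) = e := by
  have h1 := h.flip_coe (p e) ⟨e, rfl⟩
  simp only at h1
  rw [h1, h.flip_coe (p e)]
  simp

theorem Labeling.flip_ne {T U : Type*} {p : T → U} {k : U → ℕ} (h : Labeling p k) (e : T) :
    h.flip e ≠ e := by
  intro h0
  have h1 := h.flip_coe (p e) ⟨e, rfl⟩
  simp only [h0] at h1
  have h2 : (⟨e, rfl⟩ : {e' // p e' = p e}) = _ := Subtype.ext h1
  rw [Equiv.eq_symm_apply] at h2
  simpa using congrArg Prod.snd h2

/-- A colouring is compatible with a labeling if it flips along every pair. -/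
def Labeling.Compatible {T U : Type*} {p : T → U} {k : U → ℕ} (h : Labeling p k)
    (c : T → Bool) : Prop :=
  ∀ u i, c ((h u).symm (i, true)) = !c ((h u).symm (i, false))

theorem Labeling.compatible_of_flip {T U : Type*} {p : T → U} {k : U → ℕ} (h : Labeling p k)
    {c : T → Bool} (hc : ∀ e, c (h.flip e) = !c e) : h.Compatible c := by
  intro u i
  rw [← hc, h.flip_coe]
  simp

theorem Labeling.Compatible.card_eq {T U : Type*} [Fintype T] [DecidableEq U] {p : T → U}
    {k : U → ℕ} {h : Labeling p k} {c : T → Bool} (hc : h.Compatible c) (u : U) :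
    #{x : {e // p e = u} | c x = true} = k u := by
  classical
  have h1 : #{x : {e // p e = u} | c x = true}
      = ∑ y : Fin (k u) × Bool, if c ((h u).symm y) = true then 1 else 0 := by
    rw [card_filter, ← Equiv.sum_comp (h u).symm]
  rw [h1, Fintype.sum_prod_type]
  simp only [Fintype.sum_bool]
  rw [Finset.sum_congr rfl (g := fun _ => 1)]
  · simp
  · intro i _
    have := hc u i
    cases hh : c ((h u).symm (i, false)) <;> simp [hh] at this <;> simp [this]

open scoped Nat in
theorem card_compatible_le {T U : Type*} [Fintype T] [DecidableEq T] [Fintype U] [DecidableEq U]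
    {p : T → U} {k : U → ℕ} (hk : ∀ u, Fintype.card {e // p e = u} = 2 * k u) (c : T → Bool)
    (hc : ∀ u, #{x : {e // p e = u} | c x = true} = k u)
    [DecidablePred fun h : Labeling p k => h.Compatible c] :
    #{h : Labeling p k | h.Compatible c} ≤ ∏ u, 2 ^ k u * ((k u)! * (k u)!) := by
  classical
  have h1 : ({h : Labeling p k | h.Compatible c} : Finset (Labeling p k)) =
      Fintype.piFinset fun u => {h : {e // p e = u} ≃ Fin (k u) × Bool |
        ∀ i, c (h.symm (i, true)) = !c (h.symm (i, false))} := by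
    ext h
    rw [Finset.mem_filter, Fintype.mem_piFinset]
    simp [Labeling.Compatible]
  rw [h1, Fintype.card_piFinset]
  exact Finset.prod_le_prod' fun u _ => card_compatible_labelings_le (hk u) (fun x => c x) (hc u)

-- Writing `(2k)!` through the central binomial coefficient lets the factorials cancel against
-- `card_compatible_le`.
open scoped Nat in
theorem card_labeling {T U : Type*} [Fintype T] [DecidableEq T] [Fintype U] [DecidableEq U]
    {p : T → U} {k : U → ℕ} (hk : ∀ u, Fintype.card {e // p e = u} = 2 * k u) :
    Fintype.card (Labeling p k) = ∏ u, (k u).centralBinom * ((k u)! * (k u)!) := by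
  rw [Fintype.card_pi]
  refine Finset.prod_congr rfl fun u _ => ?_
  have e : {e // p e = u} ≃ Fin (k u) × Bool :=
    Fintype.equivOfCardEq (by rw [hk]; simp [mul_comm])
  rw [Fintype.card_equiv e, hk, Nat.centralBinom, ← mul_assoc]
  have := Nat.choose_mul_factorial_mul_factorial (n := 2 * k u) (k := k u) (by omega)
  rw [← this]
  congr 2
  omega

theorem prod_two_pow_mul_self_le {W : Type*} [Fintype W] (j : W → ℕ) :
    (∏ w, 2 ^ j w) * (∏ w, 2 ^ j w) ≤ (∏ w, (2 * j w + 1)) * ∏ w, (j w).centralBinom := by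
  rw [← Finset.prod_mul_distrib, ← Finset.prod_mul_distrib]
  refine Finset.prod_le_prod' fun w _ => ?_
  rw [← mul_pow]
  exact Nat.four_pow_le_two_mul_add_one_mul_central_binom (j w)

theorem card_eq_two_mul_sum {T W : Type*} [Fintype T] [Fintype W] [DecidableEq W] {r : T → W}
    {j : W → ℕ} (hj : ∀ w, Fintype.card {e // r e = w} = 2 * j w) :
    Fintype.card T = 2 * ∑ w, j w := by
  rw [Finset.mul_sum, ← Finset.sum_congr rfl fun w _ => hj w, ← Fintype.card_sigma]
  exact Fintype.card_congr (Equiv.sigmaFiberEquiv r).symm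

/-- The balanced two-colourings of a bipartite multigraph with even degrees `2k`, `2l` make up at
least a fraction `∏ 1 / (2k + 1) * ∏ 1 / (2l + 1)` of all two-colourings. -/
theorem two_pow_le_card_balanced {T U V : Type*} [Fintype T] [DecidableEq T] [Fintype U]
    [DecidableEq U] [Fintype V] [DecidableEq V] (p : T → U) (q : T → V) (k : U → ℕ) (l : V → ℕ)
    (hk : ∀ u, Fintype.card {e // p e = u} = 2 * k u)
    (hl : ∀ v, Fintype.card {e // q e = v} = 2 * l v) :
    2 ^ Fintype.card T ≤ (∏ u, (2 * k u + 1)) * (∏ v, (2 * l v + 1)) *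
      #{c : T → Bool | (∀ u, #{x : {e // p e = u} | c x = true} = k u) ∧
        ∀ v, #{x : {e // q e = v} | c x = true} = l v} := by
  classical
  set B := #{c : T → Bool | (∀ u, #{x : {e // p e = u} | c x = true} = k u) ∧
        ∀ v, #{x : {e // q e = v} | c x = true} = l v} with hB
  have hex : ∀ hh : Labeling p k × Labeling q l, ∃ c : T → Bool,
      hh.1.Compatible c ∧ hh.2.Compatible c := fun hh => by
    obtain ⟨c, h1, h2⟩ := exists_flip_coloring hh.1.flip hh.2.flip hh.1.flip_flip hh.2.flip_flip
      hh.1.flip_ne hh.2.flip_ne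
    exact ⟨c, hh.1.compatible_of_flip h1, hh.2.compatible_of_flip h2⟩
  choose f hf using hex
  -- Double counting: each pair of labelings selects a balanced colouring, and each balanced
  -- colouring is selected by few pairs.
  have hcount := Finset.card_le_mul_card_image_of_maps_to
    (s := (univ : Finset (Labeling p k × Labeling q l)))
    (t := {c : T → Bool | (∀ u, #{x : {e // p e = u} | c x = true} = k u) ∧
        ∀ v, #{x : {e // q e = v} | c x = true} = l v}) (f := f)
    (fun hh _ => by
      simp only [mem_filter, mem_univ, true_and]
      exact ⟨(hf hh).1.card_eq, (hf hh).2.card_eq⟩)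
    ((∏ u, 2 ^ k u * ((k u).factorial * (k u).factorial)) *
      ∏ v, 2 ^ l v * ((l v).factorial * (l v).factorial)) (fun c hc => by
      simp only [mem_filter, mem_univ, true_and] at hc
      calc _ ≤ #(({h : Labeling p k | h.Compatible c} : Finset _) ×ˢ
            ({h : Labeling q l | h.Compatible c} : Finset _)) := by
            refine card_le_card fun hh h0 => ?_
            simp only [mem_filter, mem_univ, true_and] at h0
            subst h0
            simpa using hf hh
        _ ≤ _ := by
            rw [card_product]
            exact Nat.mul_le_mul (card_compatible_le hk c hc.1) (card_compatible_le hl c hc.2))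
  rw [← hB, Finset.card_univ, Fintype.card_prod, card_labeling hk, card_labeling hl] at hcount
  simp only [Finset.prod_mul_distrib] at hcount
  have hcancel : (∏ u, (k u).centralBinom) * (∏ v, (l v).centralBinom) ≤
      (∏ u, 2 ^ k u) * (∏ v, 2 ^ l v) * B := by
    have hpos : 0 < ((∏ u, (k u).factorial) * ∏ u, (k u).factorial) *
        ((∏ v, (l v).factorial) * ∏ v, (l v).factorial) := by
      have h1 : 0 < ∏ u, (k u).factorial := Finset.prod_pos fun u _ => Nat.factorial_pos _
      have h2 : 0 < ∏ v, (l v).factorial := Finset.prod_pos fun u _ => Nat.factorial_pos _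
      positivity
    refine Nat.le_of_mul_le_mul_right ?_ hpos
    calc _ = _ := by ring
      _ ≤ _ := hcount
      _ = _ := by ring
  -- `∑ k` and `∑ l` are both half the number of edges. A further factor `2 ^ |T|` then produces the
  -- powers of 4 to be compared with the central binomials.
  have hU := card_eq_two_mul_sum hk
  have hV := card_eq_two_mul_sum hl
  have hT : 2 ^ Fintype.card T = (∏ u, 2 ^ k u) * ∏ v, 2 ^ l v := by
    rw [Finset.prod_pow_eq_pow_sum, Finset.prod_pow_eq_pow_sum, ← pow_add]
    congr 1
    omega
  rw [hT]
  have hpos : 0 < (∏ u, 2 ^ k u) * ∏ v, 2 ^ l v := by positivity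
  refine Nat.le_of_mul_le_mul_right ?_ hpos
  calc _ = ((∏ u, 2 ^ k u) * (∏ u, 2 ^ k u)) * ((∏ v, 2 ^ l v) * (∏ v, 2 ^ l v)) := by ring
    _ ≤ ((∏ u, (2 * k u + 1)) * ∏ u, (k u).centralBinom) *
        ((∏ v, (2 * l v + 1)) * ∏ v, (l v).centralBinom) := Nat.mul_le_mul
        (prod_two_pow_mul_self_le k) (prod_two_pow_mul_self_le l)
    _ = ((∏ u, (2 * k u + 1)) * ∏ v, (2 * l v + 1)) *
        ((∏ u, (k u).centralBinom) * ∏ v, (l v).centralBinom) := by ring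
    _ ≤ ((∏ u, (2 * k u + 1)) * ∏ v, (2 * l v + 1)) *
        ((∏ u, 2 ^ k u) * (∏ v, 2 ^ l v) * B) := Nat.mul_le_mul_left _ hcancel
    _ = _ := by ring

/-! ### Superposition of two edge sets -/

/-- The degree at `u` of the edge set `S`, where `p` sends an edge to its endpoint. -/
def deg {E U : Type*} [Fintype E] [DecidableEq U] (p : E → U) (S : E → Bool) (u : U) : ℕ :=
  #{e | p e = u ∧ S e = true}

/-- The edge sets with prescribed degrees. -/
def factors {E U V : Type*} [Fintype E] [DecidableEq E] [Fintype U] [DecidableEq U] [Fintype V]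
    [DecidableEq V] (p : E → U) (q : E → V) (r : U → ℕ) (s : V → ℕ) : Finset (E → Bool) :=
  {S | (∀ u, deg p S u = r u) ∧ ∀ v, deg q S v = s v}

theorem deg_eq_sum {E U : Type*} [Fintype E] [DecidableEq U] (p : E → U) (S : E → Bool) (u : U) :
    deg p S u = ∑ e, if p e = u then (S e).toNat else 0 := by
  rw [deg, card_filter]
  refine Finset.sum_congr rfl fun e _ => ?_
  by_cases h1 : p e = u <;> cases h2 : S e <;> simp [h1]

theorem deg_add_deg {E U : Type*} [Fintype E] [DecidableEq U] (p : E → U) {S S' A B : E → Bool}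
    (h : ∀ e, (S e).toNat + (S' e).toNat = (A e).toNat + (B e).toNat) (u : U) :
    deg p S u + deg p S' u = deg p A u + deg p B u := by
  simp only [deg_eq_sum, ← Finset.sum_add_distrib]
  refine Finset.sum_congr rfl fun e _ => ?_
  by_cases h1 : p e = u
  · simpa [h1] using h e
  · simp [h1]

theorem deg_extend {E U : Type*} [Fintype E] [DecidableEq U] (p : E → U) (D : E → Prop)
    [DecidablePred D] (c : {e // D e} → Bool) (u : U) :
    deg p (fun e => if h : D e then c ⟨e, h⟩ else false) u =
      #{x : {e : {e // D e} // p e = u} | c x = true} := by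
  symm
  refine Finset.card_bij (fun x _ => x.1.1) ?_ ?_ ?_
  · rintro ⟨⟨e, he⟩, rfl⟩ hx
    simpa [he] using hx
  · rintro ⟨⟨e, he⟩, _⟩ _ ⟨⟨e', he'⟩, _⟩ _ h
    simpa using h
  · intro e he
    simp only [mem_filter, mem_univ, true_and] at he
    by_cases hD : D e
    · exact ⟨⟨⟨e, hD⟩, he.1⟩, by simpa [hD] using he.2, rfl⟩
    · simp [hD] at he

theorem deg_decide {E U : Type*} [Fintype E] [DecidableEq U] (p : E → U) (D : E → Prop)
    [DecidablePred D] (u : U) :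
    deg p (fun e => decide (D e)) u = Fintype.card {e : {e // D e} // p e = u} := by
  have := deg_extend p D (fun _ => true) u
  simp only [filter_true, Finset.card_univ] at this
  rw [← this]
  congr 1

theorem deg_le {E U : Type*} [Fintype E] [DecidableEq U] (p : E → U) (S : E → Bool) (u : U) :
    deg p S u ≤ #{e | p e = u} :=
  card_le_card fun e he => by
    simp only [mem_filter, mem_univ, true_and] at he ⊢
    exact he.1

/-- Redistribute the edges on which `S` and `S'` differ according to `c`. -/
def recolor {E : Type*} (S S' : E → Bool) (c : {e // S e ≠ S' e} → Bool) (e : E) : Bool :=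
  if h : S e ≠ S' e then c ⟨e, h⟩ else S e

/-- At `w` the differing edges number `2 * (r - deg (S ∧ S'))`. Giving half of them to each side, on
top of the common edges, makes both degrees equal to `r`. -/
theorem exists_half_deg {E W : Type*} [Fintype E] [DecidableEq W] (t : E → W) (S S' : E → Bool)
    (w : W) (r : ℕ) (h : deg t S w + deg t S' w = 2 * r) :
    ∃ k, Fintype.card {e : {e // S e ≠ S' e} // t e = w} = 2 * k ∧ 2 * k ≤ #{e | t e = w} ∧
      ∀ c : {e // S e ≠ S' e} → Bool, #{x : {e : {e // S e ≠ S' e} // t e = w} | c x = true} = k →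
        deg t (recolor S S' c) w = r ∧ deg t (recolor S S' fun e => !c e) w = r := by
  have h0 : deg t (fun _ => false) w = 0 := by simp [deg]
  have h1 := deg_add_deg t (S := S) (S' := S') (A := fun e => S e && S' e)
    (B := fun e => S e || S' e) (fun e => by cases S e <;> cases S' e <;> rfl) w
  have h2 := deg_add_deg t (S := fun e => S e || S' e) (S' := fun _ => false)
    (A := fun e => S e && S' e) (B := fun e => decide (S e ≠ S' e))
    (fun e => by cases S e <;> cases S' e <;> rfl) w
  have h3 := deg_decide t (fun e => S e ≠ S' e) w
  have h4 := deg_le t (fun e => decide (S e ≠ S' e)) w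
  refine ⟨r - deg t (fun e => S e && S' e) w, by omega, by omega, fun c hc => ?_⟩
  rw [← deg_extend t (fun e => S e ≠ S' e) c w] at hc
  have h5 := deg_add_deg t (S := recolor S S' c) (S' := fun _ => false)
    (A := fun e => S e && S' e) (B := fun e => if h : S e ≠ S' e then c ⟨e, h⟩ else false)
    (fun e => by
      by_cases h : S e = S' e
      · simp [recolor, h]
      · have : (S e && S' e) = false := by
          revert h; cases S e <;> cases S' e <;> simp
        simp [recolor, h, this]) w
  have h6 := deg_add_deg t (S := recolor S S' c) (S' := recolor S S' fun e => !c e)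
    (A := S) (B := S') (fun e => by
      by_cases h : S e = S' e
      · simp [recolor, h]
      · simp only [recolor, ne_eq, h, not_false_eq_true, dite_true]
        generalize c ⟨e, h⟩ = b
        revert h; cases S e <;> cases S' e <;> cases b <;> simp) w
  omega

/-- The pairs of edge sets with total degrees `2r`, `2s` and prescribed union and intersection,
compared with those in which both edge sets have degrees `r`, `s`. -/
theorem card_pairs_fiber_le {E U V : Type*} [Fintype E] [DecidableEq E] [Fintype U]
    [DecidableEq U] [Fintype V] [DecidableEq V] (p : E → U) (q : E → V) (r : U → ℕ) (s : V → ℕ)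
    (κ : E → Bool × Bool) :
    #{P : (E → Bool) × (E → Bool) | ((∀ u, deg p P.1 u + deg p P.2 u = 2 * r u) ∧
        ∀ v, deg q P.1 v + deg q P.2 v = 2 * s v) ∧
        (fun e => (P.1 e && P.2 e, P.1 e || P.2 e)) = κ} ≤
      (∏ u, (#{e | p e = u} + 1)) * (∏ v, (#{e | q e = v} + 1)) *
      #{P ∈ factors p q r s ×ˢ factors p q r s |
        (fun e => (P.1 e && P.2 e, P.1 e || P.2 e)) = κ} := by
  classical
  rcases Finset.eq_empty_or_nonempty ({P : (E → Bool) × (E → Bool) |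
      ((∀ u, deg p P.1 u + deg p P.2 u = 2 * r u) ∧
        ∀ v, deg q P.1 v + deg q P.2 v = 2 * s v) ∧
        (fun e => (P.1 e && P.2 e, P.1 e || P.2 e)) = κ} : Finset _) with h0 | ⟨⟨S, S'⟩, hS⟩
  · simp [h0]
  simp only [mem_filter, mem_univ, true_and] at hS
  obtain ⟨⟨hp, hq⟩, rfl⟩ := hS
  choose k hk hk' hkc using fun u => exists_half_deg p S S' u (r u) (hp u)
  choose l hl hl' hlc using fun v => exists_half_deg q S S' v (s v) (hq v)
  have hmain := two_pow_le_card_balanced (fun e : {e // S e ≠ S' e} => p e)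
    (fun e : {e // S e ≠ S' e} => q e) k l hk hl
  have hk1 : ∏ u, (2 * k u + 1) ≤ ∏ u, (#{e | p e = u} + 1) :=
    Finset.prod_le_prod' fun u _ => Nat.add_le_add_right (hk' u) 1
  have hl1 : ∏ v, (2 * l v + 1) ≤ ∏ v, (#{e | q e = v} + 1) :=
    Finset.prod_le_prod' fun v _ => Nat.add_le_add_right (hl' v) 1
  refine le_trans ?_ (hmain.trans (Nat.mul_le_mul (Nat.mul_le_mul hk1 hl1) ?_))
  -- With union and intersection fixed, a pair is determined by its first member on the edges where
  -- `S` and `S'` differ.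
  · rw [← Fintype.card_bool, ← Fintype.card_fun, ← Finset.card_univ]
    refine Finset.card_le_card_of_injOn (fun P e => P.1 e) (fun _ _ => mem_univ _) ?_
    rintro ⟨A, A'⟩ hA ⟨B, B'⟩ hB hAB
    simp only [coe_filter, mem_univ, true_and, Set.mem_ofPred_eq] at hA hB
    have hA2 := congrFun hA.2
    have hB2 := congrFun hB.2
    have hAB' := congrFun hAB
    simp only [Prod.mk.injEq, Subtype.forall] at hA2 hB2 hAB'
    rw [Prod.mk.injEq, funext_iff, funext_iff, ← forall_and]
    intro e
    specialize hA2 e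
    specialize hB2 e
    specialize hAB' e
    revert hA2 hB2 hAB'
    cases S e <;> cases S' e <;> cases A e <;> cases A' e <;> cases B e <;> cases B' e <;> simp
  -- Conversely, a balanced colouring and its complement split those edges into a pair of factors
  -- with the same union and intersection.
  · refine Finset.card_le_card_of_injOn
      (fun c => (recolor S S' c, recolor S S' fun e => !c e)) ?_ ?_
    · intro c hc
      simp only [coe_filter, mem_univ, true_and, Set.mem_ofPred_eq] at hc
      simp only [coe_filter, mem_product, factors, mem_filter, mem_univ, true_and,
        Set.mem_ofPred_eq]
      refine ⟨⟨⟨fun u => (hkc u c (hc.1 u)).1, fun v => (hlc v c (hc.2 v)).1⟩,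
        ⟨fun u => (hkc u c (hc.1 u)).2, fun v => (hlc v c (hc.2 v)).2⟩⟩, ?_⟩
      funext e
      by_cases h : S e = S' e
      · simp [recolor, h]
      · simp only [recolor, ne_eq, h, not_false_eq_true, dite_true]
        generalize c ⟨e, h⟩ = b
        revert h; cases S e <;> cases S' e <;> cases b <;> simp
    · intro c _ c' _ hcc
      funext e
      have := congrFun (Prod.ext_iff.1 hcc).1 e.1
      simpa [recolor, e.2] using this

/-- Approximate midpoint log-concavity of the number of edge sets with prescribed degrees. -/
theorem card_pairs_le {E U V : Type*} [Fintype E] [DecidableEq E] [Fintype U]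
    [DecidableEq U] [Fintype V] [DecidableEq V] (p : E → U) (q : E → V) (r : U → ℕ) (s : V → ℕ) :
    #{P : (E → Bool) × (E → Bool) | (∀ u, deg p P.1 u + deg p P.2 u = 2 * r u) ∧
        ∀ v, deg q P.1 v + deg q P.2 v = 2 * s v} ≤
      (∏ u, (#{e | p e = u} + 1)) * (∏ v, (#{e | q e = v} + 1)) * #(factors p q r s) ^ 2 := by
  classical
  rw [sq, ← card_product]
  let f : (E → Bool) × (E → Bool) → (E → Bool × Bool) :=
    fun P e => (P.1 e && P.2 e, P.1 e || P.2 e)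
  rw [Finset.card_eq_sum_card_fiberwise (f := f) (t := univ) (fun _ _ => mem_univ _),
    Finset.card_eq_sum_card_fiberwise (s := factors p q r s ×ˢ factors p q r s) (f := f)
      (t := univ) (fun _ _ => mem_univ _), Finset.mul_sum]
  refine Finset.sum_le_sum fun κ _ => ?_
  rw [Finset.filter_filter]
  exact card_pairs_fiber_le p q r s κ

/-! ### Counting blown-up 0-1 matrices -/

/-- The number of `0`-`1` fillings of the cells of an `m × n × K` box whose row sums are `K R` and
column sums `K C`. -/
def blowupCount {m n : ℕ} (R : Fin m → ℕ) (C : Fin n → ℕ) (K : ℕ) : ℕ :=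
  #(factors (E := (Fin m × Fin n) × Fin K) (fun e => e.1.1) (fun e => e.1.2)
    (fun i => K * R i) (fun j => K * C j))

theorem deg_append {X U : Type*} [Fintype X] [DecidableEq U] (p : X → U) (K L : ℕ)
    (S : X × Fin (K + L) → Bool) (u : U) :
    deg (fun e => p e.1) S u =
      deg (fun e => p e.1) (fun e : X × Fin K => S (e.1, Fin.castAdd L e.2)) u +
      deg (fun e => p e.1) (fun e : X × Fin L => S (e.1, Fin.natAdd K e.2)) u := by
  simp only [deg_eq_sum, Fintype.sum_prod_type, Fin.sum_univ_add, Finset.sum_add_distrib]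

theorem card_row {m n K : ℕ} (i : Fin m) :
    #{e : (Fin m × Fin n) × Fin K | e.1.1 = i} = n * K := by
  have : ({e : (Fin m × Fin n) × Fin K | e.1.1 = i} : Finset _) =
      (({i} : Finset (Fin m)) ×ˢ univ) ×ˢ univ := by
    ext ⟨⟨i', j'⟩, t⟩
    simp [eq_comm]
  rw [this]
  simp

theorem card_column {m n K : ℕ} (j : Fin n) :
    #{e : (Fin m × Fin n) × Fin K | e.1.2 = j} = m * K := by
  have : ({e : (Fin m × Fin n) × Fin K | e.1.2 = j} : Finset _) =
      (univ ×ˢ ({j} : Finset (Fin n))) ×ˢ univ := by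
    ext ⟨⟨i', j'⟩, t⟩
    simp [eq_comm]
  rw [this]
  simp

/-- Cutting the box into two halves of depth `K` yields a pair with total degrees `2 * K * R` and `2
* K * C`, to which `card_pairs_le` applies. -/
theorem blowupCount_add_self_le {m n : ℕ} (R : Fin m → ℕ) (C : Fin n → ℕ) (K : ℕ) :
    blowupCount R C (K + K) ≤
      (n * K + 1) ^ m * (m * K + 1) ^ n * blowupCount R C K ^ 2 := by
  have h := card_pairs_le (E := (Fin m × Fin n) × Fin K) (fun e => e.1.1) (fun e => e.1.2)
    (fun i => K * R i) (fun j => K * C j)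
  simp only [card_row, card_column, prod_const, card_univ, Fintype.card_fin] at h
  refine le_trans ?_ h
  refine Finset.card_le_card_of_injOn (fun S => (fun e => S (e.1, Fin.castAdd K e.2),
    fun e => S (e.1, Fin.natAdd K e.2))) ?_ ?_
  · intro S hS
    simp only [factors, coe_filter, mem_univ, true_and, Set.mem_ofPred_eq] at hS ⊢
    refine ⟨fun i => ?_, fun j => ?_⟩
    · rw [← deg_append (fun x : Fin m × Fin n => x.1), hS.1 i]
      ring
    · rw [← deg_append (fun x : Fin m × Fin n => x.2), hS.2 j]
      ring
  · intro S _ S' _ h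
    funext ⟨x, t⟩
    refine Fin.addCases (fun t => ?_) (fun t => ?_) t
    · exact congrFun (Prod.ext_iff.1 h).1 (x, t)
    · exact congrFun (Prod.ext_iff.1 h).2 (x, t)

theorem mul_two_pow_add_one_le {a N : ℕ} (ha : a ≤ N) (hN : 2 ≤ N) (s : ℕ) :
    a * 2 ^ s + 1 ≤ N ^ (s + 2) := by
  have h1 : a * 2 ^ s ≤ N ^ (s + 1) := by
    rw [pow_succ']
    exact Nat.mul_le_mul ha (Nat.pow_le_pow_left hN s)
  have h2 : 1 ≤ N ^ (s + 1) := Nat.one_le_pow _ _ (by omega)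
  have h3 : 2 * N ^ (s + 1) ≤ N ^ (s + 2) := by
    rw [pow_succ' N (s + 1)]
    exact Nat.mul_le_mul_right _ hN
  omega

/-- The halving from `2 ^ (t + 1)` to `2 ^ t` costs `N ^ ((m + n) * (t + 2))`. After roots the
exponents sum to `∑ (t + 2) / 2 ^ (t + 1) = 3`, and `(s + 3) / 2 ^ s` is the tail of this series,
which makes the induction close. -/
theorem blowupCount_two_pow_le {m n : ℕ} (R : Fin m → ℕ) (C : Fin n → ℕ) {N : ℕ} (hm : m ≤ N)
    (hn : n ≤ N) (hN : 2 ≤ N) (s : ℕ) :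
    blowupCount R C (2 ^ s) * N ^ ((m + n) * (s + 3)) ≤
      (N ^ (3 * (m + n)) * blowupCount R C 1) ^ 2 ^ s := by
  induction s with
  | zero => simp [mul_comm]
  | succ s ih =>
    have h1 : (n * 2 ^ s + 1) ^ m * (m * 2 ^ s + 1) ^ n ≤ N ^ ((m + n) * (s + 2)) := by
      calc _ ≤ (N ^ (s + 2)) ^ m * (N ^ (s + 2)) ^ n :=
            Nat.mul_le_mul (Nat.pow_le_pow_left (mul_two_pow_add_one_le hn hN s) m)
              (Nat.pow_le_pow_left (mul_two_pow_add_one_le hm hN s) n)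
        _ = _ := by rw [← pow_add, ← pow_mul, mul_comm]
    have h2 := blowupCount_add_self_le R C (2 ^ s)
    rw [← mul_two, ← pow_succ] at h2
    calc _ ≤ (N ^ ((m + n) * (s + 2)) * blowupCount R C (2 ^ s) ^ 2) *
          N ^ ((m + n) * (s + 1 + 3)) :=
          Nat.mul_le_mul_right _ (h2.trans (Nat.mul_le_mul_right _ h1))
      _ = (blowupCount R C (2 ^ s) * N ^ ((m + n) * (s + 3))) ^ 2 := by
          have : N ^ ((m + n) * (s + 2)) * N ^ ((m + n) * (s + 1 + 3)) =
              (N ^ ((m + n) * (s + 3))) ^ 2 := by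
            rw [← pow_add, ← pow_mul]
            congr 1
            ring
          rw [mul_pow, ← this]
          ring
      _ ≤ ((N ^ (3 * (m + n)) * blowupCount R C 1) ^ 2 ^ s) ^ 2 := Nat.pow_le_pow_left ih 2
      _ = _ := by rw [← pow_mul, ← pow_succ]

theorem deg_decide_mem {X U : Type*} [Fintype X] [DecidableEq U] {K : ℕ}
    (A : X → Finset (Fin K)) (p : X → U) (u : U) :
    deg (fun e => p e.1) (fun e : X × Fin K => decide (e.2 ∈ A e.1)) u =
      ∑ x, if p x = u then #(A x) else 0 := by
  rw [deg_eq_sum, Fintype.sum_prod_type]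
  refine Finset.sum_congr rfl fun x _ => ?_
  by_cases h : p x = u <;> simp [h, Bool.toNat, Bool.cond_decide]

/-- Choose independently, for each cell `x`, which `M x` of its `K` copies are filled. -/
theorem prod_choose_le_blowupCount {m n : ℕ} {R : Fin m → ℕ} {C : Fin n → ℕ} {K : ℕ}
    (M : Fin m × Fin n → ℕ) (hR : ∀ i, ∑ j, M (i, j) = K * R i)
    (hC : ∀ j, ∑ i, M (i, j) = K * C j) :
    ∏ x, K.choose (M x) ≤ blowupCount R C K := by
  have h1 : ∏ x, K.choose (M x) =
      #(Fintype.piFinset fun x => powersetCard (M x) (univ : Finset (Fin K))) := by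
    simp [Fintype.card_piFinset]
  rw [h1]
  refine Finset.card_le_card_of_injOn (fun A e => decide (e.2 ∈ A e.1)) ?_ ?_
  · intro A hA
    have hA' : ∀ x, #(A x) = M x := fun x =>
      (mem_powersetCard.1 (Fintype.mem_piFinset.1 (mem_coe.1 hA) x)).2
    simp only [factors, coe_filter, mem_univ, true_and, Set.mem_ofPred_eq]
    refine ⟨fun i => ?_, fun j => ?_⟩
    · rw [deg_decide_mem A (fun x => x.1), Fintype.sum_prod_type, ← hR i]
      simp [hA', Finset.sum_ite_irrel]
    · rw [deg_decide_mem A (fun x => x.2), Fintype.sum_prod_type, ← hC j]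
      simp [hA']
  · intro A _ B _ h
    funext x
    ext t
    simpa using congrFun h (x, t)

/-! ### Entropy bound for binomial coefficients -/

open scoped Nat in
theorem choose_mul_pow_le (k d e : ℕ) :
    (k + d + e).choose (k + d) * (k ^ (k + d) * (d + e) ^ e) ≤
      (k + d + e).choose k * (k ^ k * (d + e) ^ (d + e)) := by
  have h1 : k ! * k ^ d ≤ (k + d)! := by
    simpa using Nat.factorial_mul_pow_sub_le_factorial (n := k) (m := k + d) (by omega)
  have h2 : (d + e)! ≤ e ! * (d + e) ^ d := by
    have := Nat.factorial_mul_descFactorial (n := d + e) (k := d) (by omega)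
    rw [Nat.add_sub_cancel_left] at this
    rw [← this]
    exact Nat.mul_le_mul_left _ (Nat.descFactorial_le_pow _ _)
  have h3 : (k + d + e).choose (k + d) * ((k + d)! * e !) =
      (k + d + e).choose k * (k ! * (d + e)!) := by
    have e1 := Nat.choose_mul_factorial_mul_factorial (n := k + d + e) (k := k + d) (by omega)
    have e2 := Nat.choose_mul_factorial_mul_factorial (n := k + d + e) (k := k) (by omega)
    rw [show k + d + e - (k + d) = e by omega] at e1
    rw [show k + d + e - k = d + e by omega] at e2
    rw [← mul_assoc, ← mul_assoc, e1, e2]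
  have hpos : 0 < (k + d)! * e ! := by positivity
  refine Nat.le_of_mul_le_mul_right ?_ hpos
  calc _ = ((k + d + e).choose (k + d) * ((k + d)! * e !)) * (k ^ (k + d) * (d + e) ^ e) := by ring
    _ = (k + d + e).choose k * (k ^ k * (d + e) ^ e) * ((k ! * k ^ d) * (d + e)!) := by
        rw [h3]; ring
    _ ≤ (k + d + e).choose k * (k ^ k * (d + e) ^ e) * ((k + d)! * (e ! * (d + e) ^ d)) :=
        Nat.mul_le_mul_left _ (Nat.mul_le_mul h1 h2)
    _ = _ := by ring

/-- A binomial distribution with integer mean `k` has its mode at `k`. The case `j ≤ k` follows from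
the other one by exchanging successes and failures. -/
theorem choose_mul_pow_le_self {K k j : ℕ} (hk : k ≤ K) (hj : j ≤ K) :
    K.choose j * (k ^ j * (K - k) ^ (K - j)) ≤ K.choose k * (k ^ k * (K - k) ^ (K - k)) := by
  rcases le_total k j with h | h
  · obtain ⟨d, rfl⟩ := Nat.exists_eq_add_of_le h
    obtain ⟨e, rfl⟩ := Nat.exists_eq_add_of_le hj
    have := choose_mul_pow_le k d e
    rwa [show k + d + e - k = d + e by omega, show k + d + e - (k + d) = e by omega]
  · obtain ⟨d, rfl⟩ := Nat.exists_eq_add_of_le h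
    obtain ⟨e, rfl⟩ := Nat.exists_eq_add_of_le hk
    have := choose_mul_pow_le e d j
    rw [show j + d + e - (j + d) = e by omega, show j + d + e - j = d + e by omega,
      ← Nat.choose_symm_of_eq_add (show j + d + e = (e + d) + j by omega),
      ← Nat.choose_symm_of_eq_add (show j + d + e = e + (j + d) by omega)]
    rw [show e + d + j = j + d + e by omega] at this
    rw [add_comm d e, mul_comm (_ ^ j), mul_comm (_ ^ (j + d)), add_comm j d]
    rwa [add_comm j d] at this

/-- Expand `(k + (K - k)) ^ K`: it has `K + 1` terms, and the `k`-th is the largest. -/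
theorem pow_self_le_choose {K k : ℕ} (hk : k ≤ K) :
    K ^ K ≤ (K + 1) * (K.choose k * (k ^ k * (K - k) ^ (K - k))) := by
  have h := add_pow k (K - k) K
  rw [Nat.add_sub_cancel' hk] at h
  rw [h]
  calc _ ≤ ∑ _j ∈ range (K + 1), K.choose k * (k ^ k * (K - k) ^ (K - k)) := by
        refine Finset.sum_le_sum fun j hj => ?_
        rw [mul_comm]
        exact choose_mul_pow_le_self hk (Nat.lt_succ_iff.1 (mem_range.1 hj))
    _ = _ := by simp

theorem binEntropy_le_log_choose {K k : ℕ} (hk : k ≤ K) (hK : 0 < K) :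
    K * Real.binEntropy (k / K) - Real.log (K + 1) ≤ Real.log (K.choose k) := by
  have h := pow_self_le_choose hk
  have hc : (0 : ℝ) < K.choose k := by exact_mod_cast Nat.choose_pos hk
  -- The convention `0 ^ 0 = 1` covers the endpoints `k = 0` and `k = K`.
  have hp1 : ∀ a : ℕ, (0 : ℝ) < (a : ℝ) ^ a := fun a => by
    rcases Nat.eq_zero_or_pos a with rfl | ha
    · simp
    · positivity
  have hK' : (0 : ℝ) < K := by exact_mod_cast hK
  have h' : Real.log ((K : ℝ) ^ K) ≤
      Real.log ((K + 1) * (K.choose k * ((k : ℝ) ^ k * ((K - k : ℕ) : ℝ) ^ (K - k)))) := by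
    refine Real.log_le_log (hp1 K) ?_
    exact_mod_cast h
  have hq : (0 : ℝ) < (k : ℝ) ^ k * ((K - k : ℕ) : ℝ) ^ (K - k) := mul_pos (hp1 _) (hp1 _)
  rw [Real.log_mul (by positivity) (by positivity), Real.log_mul hc.ne' hq.ne',
    Real.log_mul (hp1 _).ne' (hp1 _).ne', Real.log_pow, Real.log_pow, Real.log_pow] at h'
  have hdiv : ∀ a : ℕ, (K : ℝ) * Real.negMulLog (a / K) = a * Real.log K - a * Real.log a := by
    intro a
    rcases Nat.eq_zero_or_pos a with rfl | ha
    · simp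
    · rw [Real.negMulLog, Real.log_div (by positivity) hK'.ne']
      field_simp
      ring
  have hsub : (1 : ℝ) - k / K = ((K - k : ℕ) : ℝ) / K := by
    rw [Nat.cast_sub hk]
    field_simp
  rw [Real.binEntropy_eq_negMulLog_add_negMulLog_one_sub, mul_add, hsub, hdiv, hdiv]
  have : (k : ℝ) * Real.log K + ((K - k : ℕ) : ℝ) * Real.log K = K * Real.log K := by
    rw [Nat.cast_sub hk]; ring
  linarith

/-! ### Rounding and the counting lower bound -/

theorem sum_delta_mul {A : Type*} [CommRing A] {m : ℕ} (i₀ i : Fin m) (f : Fin m → A) :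
    ∑ i', ((if i = i' then 1 else 0) - if i = i₀ then 1 else 0) * f i' =
      f i - (if i = i₀ then 1 else 0) * ∑ i', f i' := by
  simp [sub_mul, Finset.sum_sub_distrib]

theorem sum_delta {m : ℕ} (i₀ i' : Fin m) :
    ∑ i, (((if i = i' then 1 else 0) - if i = i₀ then 1 else 0 : ℤ)) = 0 := by
  simp [Finset.sum_sub_distrib]

theorem abs_delta_le {m : ℕ} (i₀ i i' : Fin m) :
    |((if i = i' then 1 else 0) - if i = i₀ then 1 else 0 : ℝ)| ≤ 1 := by
  split_ifs <;> simp

/-- Multiples of a real matrix with integer margins are approximated by integer matrices with the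
same margins, with an error that does not depend on the multiple. -/
theorem exists_rounding {m n : ℕ} (i₀ : Fin m) (j₀ : Fin n) {Z : Matrix (Fin m) (Fin n) ℝ}
    {R : Fin m → ℕ} {C : Fin n → ℕ} (hR : ∀ i, ∑ j, Z i j = R i) (hC : ∀ j, ∑ i, Z i j = C j)
    (K : ℕ) :
    ∃ M : Fin m → Fin n → ℤ, (∀ i, ∑ j, M i j = K * R i) ∧ (∀ j, ∑ i, M i j = K * C j) ∧
      ∀ i j, |(M i j : ℝ) - K * Z i j| ≤ m * n := by
  let a : Fin m → Fin m → ℤ := fun i i' => (if i = i' then 1 else 0) - if i = i₀ then 1 else 0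
  let b : Fin n → Fin n → ℤ := fun j j' => (if j = j' then 1 else 0) - if j = j₀ then 1 else 0
  have hSR : ∑ i, (R i : ℝ) = ∑ j, (C j : ℝ) := by
    rw [← Finset.sum_congr rfl fun i _ => hR i, ← Finset.sum_congr rfl fun j _ => hC j,
      Finset.sum_comm]
  have hSZ : ∑ i, (R i : ℤ) = ∑ j, (C j : ℤ) := by exact_mod_cast hSR
  -- A matrix supported on row `i₀` and column `j₀` carries the margins. To it are added integer
  -- multiples of the matrices `(e_i' - e_i₀) ⊗ (e_j' - e_j₀)`, whose margins vanish.
  refine ⟨fun i j => K * ((if j = j₀ then (R i : ℤ) else 0) + (if i = i₀ then (C j : ℤ) else 0) -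
    (if i = i₀ then (if j = j₀ then ∑ i, (R i : ℤ) else 0) else 0)) +
    ∑ i', ∑ j', ⌊(K : ℝ) * Z i' j'⌋ * (a i i' * b j j'), fun i => ?_, fun j => ?_, fun i j => ?_⟩
  · rw [Finset.sum_add_distrib, ← Finset.mul_sum, Finset.sum_sub_distrib, Finset.sum_add_distrib]
    have h0 : ∑ j, ∑ i', ∑ j', ⌊(K : ℝ) * Z i' j'⌋ * (a i i' * b j j') = 0 := by
      rw [Finset.sum_comm]
      refine Finset.sum_eq_zero fun i' _ => ?_
      rw [Finset.sum_comm]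
      refine Finset.sum_eq_zero fun j' _ => ?_
      rw [← Finset.mul_sum, ← Finset.mul_sum, sum_delta, mul_zero, mul_zero]
    rw [h0]
    by_cases h : i = i₀ <;> simp [h, hSZ]
  · rw [Finset.sum_add_distrib, ← Finset.mul_sum, Finset.sum_sub_distrib, Finset.sum_add_distrib]
    have h0 : ∑ i, ∑ i', ∑ j', ⌊(K : ℝ) * Z i' j'⌋ * (a i i' * b j j') = 0 := by
      rw [Finset.sum_comm]
      refine Finset.sum_eq_zero fun i' _ => ?_
      rw [Finset.sum_comm]
      refine Finset.sum_eq_zero fun j' _ => ?_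
      rw [← Finset.mul_sum, ← Finset.sum_mul, sum_delta, zero_mul, mul_zero]
    rw [h0]
    by_cases h : j = j₀ <;> simp [h]
  · have hZ : ∑ i', ∑ j', Z i' j' * ((a i i' : ℝ) * b j j') =
        (Z i j - (if j = j₀ then 1 else 0) * R i) -
          (if i = i₀ then 1 else 0) * (C j - (if j = j₀ then 1 else 0) * ∑ i, (R i : ℝ)) := by
      have h1 : ∀ i', ∑ j', Z i' j' * ((a i i' : ℝ) * b j j') =
          ((if i = i' then 1 else 0) - if i = i₀ then 1 else 0) *
            (Z i' j - (if j = j₀ then 1 else 0) * R i') := by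
        intro i'
        rw [← hR i', ← sum_delta_mul j₀ j (fun j' => Z i' j'), Finset.mul_sum]
        refine Finset.sum_congr rfl fun j' _ => ?_
        simp only [a, b]
        push_cast
        ring
      rw [Finset.sum_congr rfl fun i' _ => h1 i', sum_delta_mul, Finset.sum_sub_distrib,
        ← Finset.mul_sum, hC]
    -- `K * Z` has the same expansion with coefficients `K * Z i' j'` in place of their floors, so
    -- only `m * n` rounding errors of size at most 1 remain.
    have hdiff : (((K * ((if j = j₀ then (R i : ℤ) else 0) + (if i = i₀ then (C j : ℤ) else 0) -
        (if i = i₀ then (if j = j₀ then ∑ i, (R i : ℤ) else 0) else 0)) +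
        ∑ i', ∑ j', ⌊(K : ℝ) * Z i' j'⌋ * (a i i' * b j j') : ℤ)) : ℝ) - K * Z i j =
        ∑ i', ∑ j', ((⌊(K : ℝ) * Z i' j'⌋ : ℝ) - K * Z i' j') * ((a i i' : ℝ) * b j j') := by
      simp only [sub_mul, Finset.sum_sub_distrib, mul_assoc, ← Finset.mul_sum]
      rw [hZ]
      push_cast
      by_cases hi : i = i₀ <;> by_cases hj : j = j₀ <;> simp [hi, hj] <;> ring
    rw [hdiff]
    calc _ ≤ ∑ i' : Fin m, ∑ j' : Fin n, (1 : ℝ) := by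
          refine (Finset.abs_sum_le_sum_abs _ _).trans (Finset.sum_le_sum fun i' _ =>
            (Finset.abs_sum_le_sum_abs _ _).trans (Finset.sum_le_sum fun j' _ => ?_))
          rw [abs_mul, abs_mul]
          have h1 : |(⌊(K : ℝ) * Z i' j'⌋ : ℝ) - K * Z i' j'| ≤ 1 := by
            rw [abs_le]
            constructor
            · linarith [Int.lt_floor_add_one ((K : ℝ) * Z i' j')]
            · linarith [Int.floor_le ((K : ℝ) * Z i' j')]
          have h2 : |(a i i' : ℝ)| ≤ 1 := by
            simpa [a] using abs_delta_le i₀ i i'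
          have h3 : |(b j j' : ℝ)| ≤ 1 := by
            simpa [b] using abs_delta_le j₀ j j'
          exact mul_le_one₀ h1 (by positivity) (mul_le_one₀ h2 (by positivity) h3)
      _ = _ := by simp

open Filter Topology in
/-- The number of matrices with given margins is at least the exponential of the entropy of any
interior point of the polytope, up to a polynomial factor for every row and column. -/
theorem exp_entropy_le {m n : ℕ} (i₀ : Fin m) (j₀ : Fin n) {R : Fin m → ℕ} {C : Fin n → ℕ}
    {Z : Matrix (Fin m) (Fin n) ℝ} (hZ : Z ∈ polytope R C) (hZ' : ∀ i j, 0 < Z i j ∧ Z i j < 1)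
    {N : ℕ} (hm : m ≤ N) (hn : n ≤ N) (hN : 2 ≤ N) :
    Real.exp (entropy Z) ≤ (N : ℝ) ^ (3 * (m + n)) * blowupCount R C 1 := by
  choose M hMR hMC hM using fun s : ℕ => exists_rounding i₀ j₀ hZ.1 hZ.2.1 (2 ^ s)
  have hpow : Tendsto (fun s : ℕ => ((2 ^ s : ℕ) : ℝ)) atTop atTop := by
    simpa using tendsto_pow_atTop_atTop_of_one_lt (one_lt_two : (1 : ℝ) < 2)
  have hratio : ∀ i j, Tendsto (fun s => (M s i j : ℝ) / (2 ^ s : ℕ)) atTop (𝓝 (Z i j)) := by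
    intro i j
    rw [tendsto_iff_dist_tendsto_zero]
    refine squeeze_zero (fun _ => dist_nonneg) (fun s => ?_)
      ((tendsto_const_nhds (x := (m * n : ℝ))).div_atTop hpow)
    have h2 : (0 : ℝ) < (2 ^ s : ℕ) := by positivity
    rw [Real.dist_eq, show (M s i j : ℝ) / (2 ^ s : ℕ) - Z i j =
      (M s i j - (2 ^ s : ℕ) * Z i j) / (2 ^ s : ℕ) by field_simp, abs_div, abs_of_pos h2]
    exact div_le_div_of_nonneg_right (hM s i j) h2.le
  have hlim : Tendsto (fun s : ℕ => ∑ i, ∑ j, (Real.binEntropy ((M s i j : ℝ) / (2 ^ s : ℕ)) -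
      Real.log ((2 ^ s : ℕ) + 1) / (2 ^ s : ℕ))) atTop
      (𝓝 (∑ i, ∑ j, (Real.binEntropy (Z i j) - 0))) := by
    refine tendsto_finsetSum _ fun i _ => tendsto_finsetSum _ fun j _ => ?_
    refine ((Real.binEntropy_continuous.tendsto _).comp (hratio i j)).sub ?_
    have h1 : Tendsto (fun x : ℝ => Real.log (x + 1) / x) atTop (𝓝 0) := by
      have h2 := (Real.tendsto_pow_log_div_mul_add_atTop 1 (-1) 1 one_ne_zero).comp
        (tendsto_atTop_add_const_right atTop (1 : ℝ) tendsto_id)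
      refine h2.congr fun x => ?_
      simp
    exact h1.comp hpow
  simp only [sub_zero] at hlim
  -- Since `Z` is strictly interior, the rounded entries eventually lie in `[0, 2 ^ s]` and are
  -- valid subset sizes.
  have hgood : ∀ᶠ s in atTop, ∀ i j, 0 ≤ M s i j ∧ M s i j ≤ (2 ^ s : ℕ) := by
    refine eventually_all.2 fun i => eventually_all.2 fun j => ?_
    filter_upwards [(hratio i j).eventually (lt_mem_nhds (hZ' i j).1),
      (hratio i j).eventually (gt_mem_nhds (hZ' i j).2)] with s h1 h2
    have h3 : (0 : ℝ) < (2 ^ s : ℕ) := by positivity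
    constructor
    · have := (div_pos_iff_of_pos_right h3).1 h1
      exact_mod_cast this.le
    · have := (div_lt_one h3).1 h2
      exact_mod_cast this.le
  have hbound : ∀ᶠ s : ℕ in atTop, ∑ i, ∑ j, (Real.binEntropy ((M s i j : ℝ) / (2 ^ s : ℕ)) -
      Real.log ((2 ^ s : ℕ) + 1) / (2 ^ s : ℕ)) ≤
      Real.log ((N : ℝ) ^ (3 * (m + n)) * blowupCount R C 1) ∧ 0 < blowupCount R C 1 := by
    filter_upwards [hgood] with s hs
    have hcast : ∀ i j, ((M s i j).toNat : ℤ) = M s i j := fun i j => Int.toNat_of_nonneg (hs i j).1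
    have hle : ∀ i j, (M s i j).toNat ≤ 2 ^ s := fun i j => by
      have := (hs i j).2
      rw [← hcast i j] at this
      exact_mod_cast this
    have h1 := prod_choose_le_blowupCount (R := R) (C := C) (K := 2 ^ s)
      (fun x => (M s x.1 x.2).toNat)
      (fun i => by zify [hcast]; simpa [hcast] using hMR s i)
      (fun j => by zify [hcast]; simpa [hcast] using hMC s j)
    have h2 := blowupCount_two_pow_le R C hm hn hN s
    have h3 : ∏ x : Fin m × Fin n, (2 ^ s).choose (M s x.1 x.2).toNat ≤
        (N ^ (3 * (m + n)) * blowupCount R C 1) ^ 2 ^ s :=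
      h1.trans ((Nat.le_mul_of_pos_right _ (by positivity)).trans h2)
    have hpos : ∀ x : Fin m × Fin n, 0 < (2 ^ s).choose (M s x.1 x.2).toNat := fun x =>
      Nat.choose_pos (hle _ _)
    have hpos' : 0 < ∏ x : Fin m × Fin n, (2 ^ s).choose (M s x.1 x.2).toNat :=
      Finset.prod_pos fun x _ => hpos x
    refine ⟨?_, ?_⟩
    · have h4 : Real.log ((∏ x : Fin m × Fin n, (2 ^ s).choose (M s x.1 x.2).toNat : ℕ) : ℝ) ≤
          Real.log ((((N ^ (3 * (m + n)) * blowupCount R C 1) ^ 2 ^ s : ℕ)) : ℝ) :=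
        Real.log_le_log (by exact_mod_cast hpos') (by exact_mod_cast h3)
      rw [Nat.cast_prod, Real.log_prod (fun x _ => by exact_mod_cast (hpos x).ne'),
        Nat.cast_pow (_ * _), Real.log_pow, Nat.cast_mul, Nat.cast_pow N] at h4
      have h5 : (0 : ℝ) < (2 ^ s : ℕ) := by positivity
      refine le_of_mul_le_mul_left (le_trans ?_ h4) h5
      rw [Fintype.sum_prod_type, Finset.mul_sum]
      refine Finset.sum_le_sum fun i _ => ?_
      rw [Finset.mul_sum]
      refine Finset.sum_le_sum fun j _ => ?_
      have h6 := binEntropy_le_log_choose (hle i j) (by positivity)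
      have h7 : (((M s i j).toNat : ℕ) : ℝ) = M s i j := by exact_mod_cast hcast i j
      rw [h7] at h6
      refine le_trans (le_of_eq ?_) h6
      field_simp
    -- Positivity is recorded separately: as `Real.log 0 = 0`, the logarithmic bound alone could not
    -- be exponentiated.
    · by_contra h0
      have h0' : blowupCount R C 1 = 0 := by omega
      rw [h0', mul_zero, zero_pow (by positivity)] at h3
      omega
  obtain ⟨s, hs⟩ := hbound.exists
  have h := le_of_tendsto hlim (hbound.mono fun s hs => hs.1)
  have hpos : (0 : ℝ) < (N : ℝ) ^ (3 * (m + n)) * blowupCount R C 1 := by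
    have h1 : (0 : ℝ) < blowupCount R C 1 := by exact_mod_cast hs.2
    have h2 : (0 : ℝ) < N := by exact_mod_cast (by omega : 0 < N)
    positivity
  rw [← Real.exp_log hpos]
  exact Real.exp_le_exp.2 h

/-- The `0`-`1` matrices counted by `blowupCount R C 1`. -/
theorem exists_finset_zeroOneMatrices {m n : ℕ} (R : Fin m → ℕ) (C : Fin n → ℕ) :
    ∃ s : Finset (Matrix (Fin m) (Fin n) ℝ), (∀ D ∈ s, D ∈ zeroOneMatrices R C) ∧
      #s = blowupCount R C 1 := by
  classical
  let f : ((Fin m × Fin n) × Fin 1 → Bool) → Matrix (Fin m) (Fin n) ℝ :=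
    fun S i j => (S ((i, j), 0)).toNat
  have hf : Function.Injective f := by
    intro S S' h
    funext ⟨⟨i, j⟩, t⟩
    have h1 := congrFun (congrFun h i) j
    simp only [f, Nat.cast_inj] at h1
    rw [Subsingleton.elim t 0]
    revert h1
    cases S ((i, j), 0) <;> cases S' ((i, j), 0) <;> simp
  refine ⟨(factors (E := (Fin m × Fin n) × Fin 1) (fun e => e.1.1) (fun e => e.1.2)
    (fun i => 1 * R i) (fun j => 1 * C j)).image f, ?_, card_image_of_injective _ hf⟩
  intro D hD
  obtain ⟨S, hS, rfl⟩ := mem_image.1 hD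
  simp only [factors, mem_filter, mem_univ, true_and, one_mul] at hS
  refine ⟨fun i => ?_, fun j => ?_, fun i j => ?_⟩
  · rw [← hS.1 i, deg_eq_sum, Fintype.sum_prod_type, Fintype.sum_prod_type, Finset.sum_comm]
    simp [f]
  · rw [← hS.2 j, deg_eq_sum, Fintype.sum_prod_type, Fintype.sum_prod_type]
    simp [f]
  · simp only [f]
    cases S ((i, j), 0) <;> simp

/-! ### The maximum entropy matrix -/

/-- The entropy has infinite slope at the boundary, so its maximizer is an interior point. -/
theorem IsMaxEntropyMatrix.mem_Ioo {m n : ℕ} {R : Fin m → ℕ} {C : Fin n → ℕ}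
    {Z : Matrix (Fin m) (Fin n) ℝ} (hZ : IsMaxEntropyMatrix R C Z) (hY : HasNonemptyInterior R C)
    (i : Fin m) (j : Fin n) : 0 < Z i j ∧ Z i j < 1 := by
  obtain ⟨Y, hYP, hY⟩ := hY
  obtain ⟨⟨hZR, hZC, hZ01⟩, hmax⟩ := hZ
  by_contra hbad
  have hbad' : Z i j = 0 ∨ Z i j = 1 := by
    rcases (hZ01 i j).1.lt_or_eq with h | h
    · rcases (hZ01 i j).2.lt_or_eq with h' | h'
      · exact absurd ⟨h, h'⟩ hbad
      · exact Or.inr h'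
    · exact Or.inl h.symm
  -- The symmetry `x ↦ 1 - x` of the binary entropy reduces a boundary entry 1 to a boundary entry
  -- 0.
  obtain ⟨w, hw0, hw1, hw, hbZ⟩ : ∃ w : ℝ, 0 < w ∧ w < 1 ∧
      (∀ t, Real.binEntropy ((1 - t) * Z i j + t * Y i j) = Real.binEntropy (t * w)) ∧
      Real.binEntropy (Z i j) = 0 := by
    rcases hbad' with h | h
    · exact ⟨Y i j, (hY i j).1, (hY i j).2, fun t => by rw [h]; ring_nf, by simp [h]⟩
    · refine ⟨1 - Y i j, by linarith [(hY i j).2], by linarith [(hY i j).1], fun t => ?_, by simp [h]⟩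
      rw [← Real.binEntropy_one_sub, h]
      ring_nf
  set L : ℝ := (m * n : ℝ) * Real.log 2 with hL
  have hL0 : 0 ≤ L := by
    have := Real.log_nonneg (one_le_two : (1 : ℝ) ≤ 2)
    positivity
  -- Move a fraction `t` of the way to `Y`. By concavity each entry loses at most `t * log 2`, so
  -- the losses total at most `t * L`. This `t` is small enough that the boundary entry alone gains
  -- at least `t * L + t`, contradicting maximality.
  set t : ℝ := Real.exp (-((L + 1) / w)) with ht
  have ht0 : 0 < t := Real.exp_pos _
  have ht1 : t ≤ 1 := Real.exp_le_one_iff.2 (neg_nonpos.2 (by positivity))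
  have hX := hmax (fun i j => (1 - t) * Z i j + t * Y i j) ⟨fun i => by
      rw [Finset.sum_add_distrib, ← Finset.mul_sum, ← Finset.mul_sum, hZR, hYP.1]; ring,
    fun j => by
      rw [Finset.sum_add_distrib, ← Finset.mul_sum, ← Finset.mul_sum, hZC, hYP.2.1]; ring,
    fun i j => by
      have h1 := hZ01 i j
      have h2 := hYP.2.2 i j
      constructor
      · exact add_nonneg (mul_nonneg (by linarith) h1.1) (mul_nonneg ht0.le h2.1)
      · nlinarith⟩
  let g : Fin m → Fin n → ℝ := fun i j =>
    Real.binEntropy ((1 - t) * Z i j + t * Y i j) - Real.binEntropy (Z i j) + t * Real.log 2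
  have hg : ∀ i j, 0 ≤ g i j := by
    intro i j
    have h1 := Real.strictConcave_binEntropy.concaveOn.2 (Set.mem_Icc.2 (hZ01 i j))
      (Set.mem_Icc.2 (hYP.2.2 i j)) (sub_nonneg.2 ht1) ht0.le (sub_add_cancel 1 t)
    simp only [smul_eq_mul] at h1
    have h2 := Real.binEntropy_nonneg (hYP.2.2 i j).1 (hYP.2.2 i j).2
    have h3 := mul_le_mul_of_nonneg_left (Real.binEntropy_le_log_two (p := Z i j)) ht0.le
    have h4 := mul_nonneg ht0.le h2
    simp only [g]
    linarith
  have hsum : ∑ i, ∑ j, g i j ≤ t * L := by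
    simp only [g, Finset.sum_add_distrib, Finset.sum_sub_distrib]
    simp only [entropy] at hX
    simp only [sum_const, card_univ, Fintype.card_fin, nsmul_eq_mul, hL]
    linarith
  have hsingle : g i j ≤ t * L :=
    ((single_le_sum (fun j _ => hg i j) (mem_univ j)).trans
      (single_le_sum (f := fun i => ∑ j, g i j) (fun i _ => sum_nonneg fun j _ => hg i j)
        (mem_univ i))).trans hsum
  have htw0 : 0 < t * w := mul_pos ht0 hw0
  have htw1 : t * w ≤ 1 := mul_le_one₀ ht1 hw0.le hw1.le
  have hbw : t * w * ((L + 1) / w) ≤ Real.binEntropy (t * w) := by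
    rw [Real.binEntropy_eq_negMulLog_add_negMulLog_one_sub]
    have h1 : 0 ≤ Real.negMulLog (1 - t * w) :=
      Real.negMulLog_nonneg (by linarith) (by linarith)
    have h2 : (L + 1) / w ≤ -Real.log (t * w) := by
      rw [Real.log_mul ht0.ne' hw0.ne', ht, Real.log_exp]
      have := Real.log_nonpos hw0.le hw1.le
      linarith
    have h3 := mul_le_mul_of_nonneg_left h2 htw0.le
    rw [Real.negMulLog]
    linarith
  have hbw' : t * w * ((L + 1) / w) = t * L + t := by field_simp
  simp only [g, hw, hbZ] at hsingle
  have h2 : 0 ≤ t * Real.log 2 := mul_nonneg ht0.le (Real.log_nonneg one_le_two)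
  linarith

open Filter Topology in
/-- The first-order condition at an interior maximum entropy matrix. -/
theorem IsMaxEntropyMatrix.sum_eq_zero {m n : ℕ} {R : Fin m → ℕ} {C : Fin n → ℕ}
    {Z : Matrix (Fin m) (Fin n) ℝ} (hZ : IsMaxEntropyMatrix R C Z)
    (hZ' : ∀ i j, 0 < Z i j ∧ Z i j < 1) {D : Matrix (Fin m) (Fin n) ℝ} (hD : D ∈ polytope R C) :
    ∑ i, ∑ j, (Real.log (1 - Z i j) - Real.log (Z i j)) * (D i j - Z i j) = 0 := by
  let X : ℝ → Matrix (Fin m) (Fin n) ℝ := fun t i j => Z i j + t * (D i j - Z i j)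
  have hXd : ∀ i j, HasDerivAt (fun t => X t i j) (D i j - Z i j) 0 := fun i j => by
    have h := ((hasDerivAt_id (0 : ℝ)).mul_const (D i j - Z i j)).const_add (Z i j)
    rw [one_mul] at h
    exact h
  have hX0 : ∀ i j, X 0 i j = Z i j := fun i j => by simp [X]
  have hderiv : HasDerivAt (fun t => entropy (X t))
      (∑ i, ∑ j, (Real.log (1 - Z i j) - Real.log (Z i j)) * (D i j - Z i j)) 0 := by
    refine HasDerivAt.fun_sum fun i _ => HasDerivAt.fun_sum fun j _ => ?_
    have h := Real.hasDerivAt_binEntropy (hZ' i j).1.ne' (hZ' i j).2.ne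
    rw [← hX0 i j] at h
    have := h.comp 0 (hXd i j)
    rw [hX0] at this
    exact this
  -- Interiority of `Z` keeps the line through `Z` and `D` inside the polytope for small `t` of
  -- either sign, so the derivative vanishes and is not merely nonpositive.
  have hmem : ∀ᶠ t in 𝓝 (0 : ℝ), X t ∈ polytope R C := by
    have h01 : ∀ᶠ t in 𝓝 (0 : ℝ), ∀ i j, 0 ≤ X t i j ∧ X t i j ≤ 1 := by
      refine eventually_all.2 fun i => eventually_all.2 fun j => ?_
      have hc := (hXd i j).continuousAt
      have h1 : 0 < X 0 i j := by rw [hX0]; exact (hZ' i j).1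
      have h2 : X 0 i j < 1 := by rw [hX0]; exact (hZ' i j).2
      filter_upwards [hc.eventually (lt_mem_nhds h1), hc.eventually (gt_mem_nhds h2)] with t h3 h4
      exact ⟨h3.le, h4.le⟩
    filter_upwards [h01] with t ht
    refine ⟨fun i => ?_, fun j => ?_, ht⟩
    · simp only [X]
      rw [Finset.sum_add_distrib, ← Finset.mul_sum, Finset.sum_sub_distrib, hZ.1.1, hD.1]
      ring
    · simp only [X]
      rw [Finset.sum_add_distrib, ← Finset.mul_sum, Finset.sum_sub_distrib, hZ.1.2.1, hD.2.1]
      ring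
  have hlocal : IsLocalMax (fun t => entropy (X t)) 0 := by
    filter_upwards [hmem] with t ht
    have : X 0 = Z := by ext i j; exact hX0 i j
    rw [this]
    exact hZ.2 _ ht
  exact hlocal.hasDerivAt_eq_zero hderiv

theorem zeroOneMatrices_subset_polytope {m n : ℕ} (R : Fin m → ℕ) (C : Fin n → ℕ) :
    zeroOneMatrices R C ⊆ polytope R C := fun D hD =>
  ⟨hD.1, hD.2.1, fun i j => by rcases hD.2.2 i j with h | h <;> simp [h]⟩

/-! ### The random matrix -/

theorem IsBernoulli.measureReal_eq {Ω : Type*} [MeasurableSpace Ω] {μ : Measure Ω} {x : Ω → ℝ}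
    (hx : IsBernoulli μ x) {z d : ℝ} (hz : ∫ ω, x ω ∂μ = z) (hd : d = 0 ∨ d = 1) :
    μ.real {ω | x ω = d} = d * z + (1 - d) * (1 - z) := by
  classical
  obtain ⟨q, hq⟩ := hx
  have h1 := hq.integral_eq
  rw [hz, integral_bernoulliMeasure] at h1
  rw [hq.measureReal_eq (p := fun y => y = d) (measurableSet_singleton d),
    Set.ofPred_eq_eq_singleton, bernoulliMeasure_real_apply q (measurableSet_singleton d)]
  rcases hd with rfl | rfl <;> simp [h1]

theorem IsBernoulliMatrix.measureReal_eq_prod {Ω : Type*} [MeasurableSpace Ω] {μ : Measure Ω}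
    {m n : ℕ} {X : Ω → Matrix (Fin m) (Fin n) ℝ} {Z : Matrix (Fin m) (Fin n) ℝ}
    (hX : IsBernoulliMatrix μ X Z) {D : Matrix (Fin m) (Fin n) ℝ}
    (hD : ∀ i j, D i j = 0 ∨ D i j = 1) :
    μ.real {ω | X ω = D} = ∏ i, ∏ j, (D i j * Z i j + (1 - D i j) * (1 - Z i j)) := by
  have h1 : {ω | X ω = D} = ⋂ p ∈ (univ : Finset (Fin m × Fin n)),
      (fun ω => X ω p.1 p.2) ⁻¹' {D p.1 p.2} := by
    ext ω
    simp only [mem_univ, Set.iInter_true, Set.mem_iInter, Set.mem_preimage,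
      Set.mem_singleton_iff, Prod.forall, Set.mem_ofPred_eq]
    exact ⟨fun h i j => by rw [h], fun h => by ext i j; exact h i j⟩
  rw [measureReal_def, h1, hX.indep.measure_inter_preimage_eq_mul univ
    (fun _ _ => measurableSet_singleton _), ENNReal.toReal_prod, Fintype.prod_prod_type]
  refine Finset.prod_congr rfl fun i _ => Finset.prod_congr rfl fun j _ => ?_
  exact (hX.bernoulli i j).measureReal_eq (hX.expectation i j) (hD i j)

/-- The law makes the entries only almost everywhere measurable, so additivity over the matrices `D`
has to use null-measurable sets. -/
theorem IsBernoulliMatrix.nullMeasurableSet {Ω : Type*} [MeasurableSpace Ω] {μ : Measure Ω}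
    {m n : ℕ} {X : Ω → Matrix (Fin m) (Fin n) ℝ} {Z : Matrix (Fin m) (Fin n) ℝ}
    (hX : IsBernoulliMatrix μ X Z) (D : Matrix (Fin m) (Fin n) ℝ) :
    NullMeasurableSet {ω | X ω = D} μ := by
  have h1 : {ω | X ω = D} = ⋂ i, ⋂ j, (fun ω => X ω i j) ⁻¹' {D i j} := by
    ext ω
    simp only [Set.mem_iInter, Set.mem_preimage, Set.mem_singleton_iff, Set.mem_ofPred_eq]
    exact ⟨fun h i j => by rw [h], fun h => by ext i j; exact h i j⟩
  rw [h1]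
  refine NullMeasurableSet.iInter fun i => NullMeasurableSet.iInter fun j => ?_
  obtain ⟨q, hq⟩ := hX.bernoulli i j
  exact hq.aemeasurable.nullMeasurable (measurableSet_singleton _)

/-- For `d ∈ {0, 1}` the log-weight of an entry is the binary entropy at `z`, negated, minus its
derivative at `z` times `d - z`. The linear terms cancel in the sum by `sum_eq_zero`. -/
theorem IsBernoulliMatrix.measureReal_eq_exp {Ω : Type*} [MeasurableSpace Ω] {μ : Measure Ω}
    {m n : ℕ} {X : Ω → Matrix (Fin m) (Fin n) ℝ} {R : Fin m → ℕ} {C : Fin n → ℕ}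
    {Z : Matrix (Fin m) (Fin n) ℝ} (hX : IsBernoulliMatrix μ X Z) (hZ : IsMaxEntropyMatrix R C Z)
    (hZ' : ∀ i j, 0 < Z i j ∧ Z i j < 1) {D : Matrix (Fin m) (Fin n) ℝ}
    (hD : D ∈ zeroOneMatrices R C) :
    μ.real {ω | X ω = D} = Real.exp (-entropy Z) := by
  have hsum := hZ.sum_eq_zero hZ' (zeroOneMatrices_subset_polytope R C hD)
  have hterm : ∀ i j, D i j * Z i j + (1 - D i j) * (1 - Z i j) =
      Real.exp (-Real.binEntropy (Z i j) -
        (Real.log (1 - Z i j) - Real.log (Z i j)) * (D i j - Z i j)) := by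
    intro i j
    have h0 := (hZ' i j).1
    have h1 : 0 < 1 - Z i j := by linarith [(hZ' i j).2]
    rw [Real.binEntropy, Real.log_inv, Real.log_inv]
    rcases hD.2.2 i j with h | h
    · rw [h]
      ring_nf
      rw [Real.exp_log h1]
    · rw [h]
      ring_nf
      rw [Real.exp_log h0]
  rw [hX.measureReal_eq_prod hD.2.2]
  simp only [hterm]
  simp only [← Real.exp_sum, Finset.sum_sub_distrib, Finset.sum_neg_distrib]
  simp only [hsum, sub_zero, entropy]

theorem IsBernoulliMatrix.blowupCount_mul_le {Ω : Type*} [MeasurableSpace Ω] {μ : Measure Ω}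
    [IsFiniteMeasure μ] {m n : ℕ} {X : Ω → Matrix (Fin m) (Fin n) ℝ} {R : Fin m → ℕ}
    {C : Fin n → ℕ} {Z : Matrix (Fin m) (Fin n) ℝ} (hX : IsBernoulliMatrix μ X Z)
    (hZ : IsMaxEntropyMatrix R C Z) (hZ' : ∀ i j, 0 < Z i j ∧ Z i j < 1) :
    blowupCount R C 1 * Real.exp (-entropy Z) ≤ μ.real {ω | X ω ∈ zeroOneMatrices R C} := by
  obtain ⟨s, hs, hcard⟩ := exists_finset_zeroOneMatrices R C
  have hdisj : (s : Set (Matrix (Fin m) (Fin n) ℝ)).PairwiseDisjoint fun D => {ω | X ω = D} := by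
    intro D _ D' _ hne
    refine Set.disjoint_left.2 fun ω h h' => hne ?_
    simp only [Set.mem_ofPred_eq] at h h'
    rw [← h, h']
  have hU := measureReal_biUnion_finset₀ (μ := μ) (s := s) (f := fun D => {ω | X ω = D})
    hdisj.aedisjoint (fun D _ => hX.nullMeasurableSet D)
  have hle : μ.real (⋃ D ∈ s, {ω | X ω = D}) ≤ μ.real {ω | X ω ∈ zeroOneMatrices R C} := by
    refine measureReal_mono fun ω hω => ?_
    simp only [Set.mem_iUnion, Set.mem_ofPred_eq, exists_prop] at hω ⊢
    obtain ⟨D, hD, rfl⟩ := hω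
    exact hs _ hD
  rw [hU, Finset.sum_congr rfl fun D hD => hX.measureReal_eq_exp hZ hZ' (hs D hD), sum_const,
    hcard, nsmul_eq_mul] at hle
  exact hle

/-- Positive margins with an interior point force either the empty matrix or at least two
cells. -/
theorem HasNonemptyInterior.eq_zero_or_two_le {m n : ℕ} {R : Fin m → ℕ} {C : Fin n → ℕ}
    (hR : ∀ i, 0 < R i) (hC : ∀ j, 0 < C j) (hY : HasNonemptyInterior R C) :
    (m = 0 ∧ n = 0) ∨ (0 < m ∧ 0 < n ∧ 2 ≤ m * n) := by
  obtain ⟨Y, hYP, hY⟩ := hY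
  rcases Nat.eq_zero_or_pos m with rfl | hm
  · rcases Nat.eq_zero_or_pos n with rfl | hn
    · exact Or.inl ⟨rfl, rfl⟩
    · have h := hYP.2.1 ⟨0, hn⟩
      have h' := hC ⟨0, hn⟩
      simp only [Finset.univ_eq_empty, Finset.sum_empty] at h
      have : C ⟨0, hn⟩ = 0 := by exact_mod_cast h.symm
      omega
  · rcases Nat.eq_zero_or_pos n with rfl | hn
    · have h := hYP.1 ⟨0, hm⟩
      have h' := hR ⟨0, hm⟩
      simp only [Finset.univ_eq_empty, Finset.sum_empty] at h
      have : R ⟨0, hm⟩ = 0 := by exact_mod_cast h.symm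
      omega
    · refine Or.inr ⟨hm, hn, ?_⟩
      by_contra hlt
      have h1 : 0 < m * n := Nat.mul_pos hm hn
      -- A single cell would hold a positive integer smaller than 1.
      obtain ⟨rfl, rfl⟩ : m = 1 ∧ n = 1 := mul_eq_one.1 (by omega)
      have h := hYP.1 0
      have h' := hR 0
      simp only [Finset.univ_unique, Fin.default_eq_zero, Finset.sum_singleton] at h
      have h2 := (hY 0 0).2
      rw [h] at h2
      have h3 : R 0 < 1 := by exact_mod_cast h2
      omega

end Margins

/-! ### The probability bound with `γ = 3` -/

theorem theorem6p1 :
    ∃ γ : ℝ, 0 < γ ∧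
      ∀ (m n : ℕ) (R : Fin m → ℕ) (C : Fin n → ℕ),
        (∀ i, 0 < R i) → (∀ j, 0 < C j) →
        Margins.HasNonemptyInterior R C →
        ∀ Z₀ : Matrix (Fin m) (Fin n) ℝ, Margins.IsMaxEntropyMatrix R C Z₀ →
        ∀ {Ω : Type*} [MeasurableSpace Ω] (μ : Measure Ω) [IsProbabilityMeasure μ]
          (X : Ω → Matrix (Fin m) (Fin n) ℝ), Margins.IsBernoulliMatrix μ X Z₀ →
          ((∀ D ∈ Margins.zeroOneMatrices R C, ∀ D' ∈ Margins.zeroOneMatrices R C,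
              μ.real {ω | X ω = D} = μ.real {ω | X ω = D'}) ∧
            ∀ D ∈ Margins.zeroOneMatrices R C,
              μ.real {ω | X ω = D} = Real.exp (-Margins.entropy Z₀)) ∧
          ((m * n : ℕ) : ℝ) ^ (-γ * ((m : ℝ) + (n : ℝ))) ≤
            μ.real {ω | X ω ∈ Margins.zeroOneMatrices R C} := by
  refine ⟨3, by norm_num, ?_⟩
  intro m n R C hR hC hint Z₀ hZ Ω _ μ _ X hX
  have hZ' := hZ.mem_Ioo hint
  have hmass : ∀ D ∈ Margins.zeroOneMatrices R C,
      μ.real {ω | X ω = D} = Real.exp (-Margins.entropy Z₀) :=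
    fun D hD => hX.measureReal_eq_exp hZ hZ' hD
  refine ⟨⟨fun D hD D' hD' => by rw [hmass D hD, hmass D' hD'], hmass⟩, ?_⟩
  rcases hint.eq_zero_or_two_le hR hC with ⟨rfl, rfl⟩ | ⟨hm, hn, hN⟩
  -- For the empty matrix the bound reads `0 ^ 0 = 1 ≤ 1`.
  · have : {ω | X ω ∈ Margins.zeroOneMatrices R C} = Set.univ := by
      ext ω
      simp [Margins.zeroOneMatrices]
    simp [this]
  -- `N = m * n` dominates both dimensions and is at least 2, as the absorption of constants into
  -- powers of `N` requires.
  · have hexp := Margins.exp_entropy_le (N := m * n) ⟨0, hm⟩ ⟨0, hn⟩ hZ.1 hZ'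
      (Nat.le_mul_of_pos_right m hn) (Nat.le_mul_of_pos_left n hm) hN
    have hpos : (0 : ℝ) < ((m * n : ℕ) : ℝ) := by exact_mod_cast (by omega : 0 < m * n)
    have hrpow : ((m * n : ℕ) : ℝ) ^ (-3 * ((m : ℝ) + (n : ℝ))) =
        (((m * n : ℕ) : ℝ) ^ (3 * (m + n)))⁻¹ := by
      rw [← Real.rpow_natCast, ← Real.rpow_neg hpos.le]
      congr 1
      push_cast
      ring
    refine le_trans ?_ (hX.blowupCount_mul_le hZ hZ')
    rw [hrpow, Real.exp_neg, ← div_eq_mul_inv, le_div_iff₀ (Real.exp_pos _),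
      inv_mul_le_iff₀ (by positivity)]
    exact hexp
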